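/- For $\mu>0$ and $n\in\mathbb N$ let $F^2_\mu(\mathbb R^n)$ be the real Bergmann–Fock space, i.e. the Hilbert space of entire functions $h(x)=\sum_{\alpha\in\mathbb N^n}a_\alpha x^\alpha$ on $\mathbb R^n$ with real coefficients and $\|h\|^2=\sum_\alpha |a_\alpha|^2\mu^{|\alpha|}\alpha!<\infty$; it is the reproducing kernel Hilbert space with kernel $K_\mu(x,y)=\exp(x^\top y/\mu)$. Let $0<\mu_r<\mu_d$, $H_d=F^2_{\mu_d}(\mathbb R^n)$, $H_r=F^2_{\mu_r}(\mathbb R^n)$, let $X\subset\mathbb R^n$ be compact and let $f:\mathbb R^n\to\mathbb R^n$ be component-wise polynomial. For $i=1,2,\dots$ let $T_i\ge 0$ and let $\gamma_i:[0,T_i]\to X$ be continuous (for instance a solution of $\dot x=f(x)$). Let $d_i=K_{\mu_d}(\cdot,\gamma_i(T_i))-K_{\mu_d}(\cdot,\gamma_i(0))\in H_d$ be the kernel differences and $r_i=\int_0^{T_i}K_{\mu_r}(\cdot,\gamma_i(t))\,dt\in H_r$ the occupation kernels, so that $\langle g,r_i\rangle_{H_r}=\int_0^{T_i}g(\gamma_i(t))\,dt$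 for all $g\in H_r$. Assume that the span of $\{r_i\}_{i\ge1}$ is dense in $H_r$ and that the span of $\{1\}\cup\{d_i\}_{i\ge1}$, where $1$ is the constant function, is dense in $H_d$ (equivalently, the span of $\{d_i\}_{i\ge1}$ is dense in the orthogonal complement $\{h\in H_d : h(0)=0\}$ of the constants). Then $A_fg=\nabla g\cdot f$ defines a bounded linear operator $A_f:H_d\to H_r$. Let $P_{d^M}$ and $P_{r^M}$ be the orthogonal projections of $H_d$ and $H_r$ onto $\operatorname{span}\{d_1,\dots,d_M\}$ and $\operatorname{span}\{r_1,\dots,r_M\}$, let $(h_{\mathrm{id}})_j\in H_d$ be the function $x\mapsto x_j$, and let $\hat f_M:\mathbb R^n\to\mathbb R^n$ be the SLDMD model with components $(\hat f_M)_j=P_{r^M}A_fP_{d^M}(h_{\mathrm{id}})_j$, $j=1,\dots,n$. Then $$\lim_{M\to\infty}\ \sup_{x\in X}\bigl\|\hat f_M(x)-f(x)\bigr\|_2=0 .$$ -/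

import Mathlib

open Filter Topology MeasureTheory

noncomputable section

namespace BergmannFock

/-- The monomial `x ^ α / √(μ ^ |α| * α!)`. These are the members of the orthonormal monomial
basis of the real Bergmann-Fock space `F²_μ(ℝⁿ)`. -/
def basisFun {n : ℕ} (μ : ℝ) (α : Fin n → ℕ) (x : EuclideanSpace ℝ (Fin n)) : ℝ :=
  (∏ i, x i ^ α i) / √(μ ^ (∑ i, α i) * ∏ i, ((α i).factorial : ℝ))

/-- The real Bergmann-Fock space `F²_μ(ℝⁿ)`. An element is given by its square summable family of
coefficients `c α` with respect to the orthonormal basis `basisFun μ α`. With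
`a α = c α / √(μ ^ |α| * α!)` it is the entire function `x ↦ ∑ α, a α * x ^ α`, and its squared
norm is `∑ α, |a α| ^ 2 * μ ^ |α| * α!`. -/
def Fock (n : ℕ) (_μ : ℝ) : Type := lp (fun _ : Fin n → ℕ => ℝ) 2

instance (n : ℕ) (μ : ℝ) : NormedAddCommGroup (Fock n μ) :=
  inferInstanceAs (NormedAddCommGroup (lp (fun _ : Fin n → ℕ => ℝ) 2))

instance (n : ℕ) (μ : ℝ) : InnerProductSpace ℝ (Fock n μ) :=
  inferInstanceAs (InnerProductSpace ℝ (lp (fun _ : Fin n → ℕ => ℝ) 2))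

instance (n : ℕ) (μ : ℝ) : CompleteSpace (Fock n μ) :=
  inferInstanceAs (CompleteSpace (lp (fun _ : Fin n → ℕ => ℝ) 2))

/-- The coefficients of an element with respect to the orthonormal basis `basisFun μ`. -/
def Fock.coeff {n : ℕ} {μ : ℝ} (g : Fock n μ) : (Fin n → ℕ) → ℝ :=
  (show lp (fun _ : Fin n → ℕ => ℝ) 2 from g)

/-- The element of `F²_μ(ℝⁿ)` that is the basis monomial `basisFun μ α`. -/
def Fock.basis {n : ℕ} (μ : ℝ) (α : Fin n → ℕ) : Fock n μ :=
  (lp.single 2 α (1 : ℝ) : lp (fun _ : Fin n → ℕ => ℝ) 2)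

/-! ### The elements are functions with bounded point evaluations -/

theorem hasSum_prod_exp (n : ℕ) (t : Fin n → ℝ) :
    (Summable fun α : Fin n → ℕ => ‖∏ i, t i ^ α i / ((α i).factorial : ℝ)‖) ∧
      HasSum (fun α : Fin n → ℕ => ∏ i, t i ^ α i / ((α i).factorial : ℝ))
        (∏ i, Real.exp (t i)) := by
  induction n with
  | zero =>
    have h : HasSum (fun α : Fin 0 → ℕ => ∏ i, t i ^ α i / ((α i).factorial : ℝ)) 1 := by
      simp
    exact ⟨h.summable.norm, by simp⟩
  | succ n ih =>
    obtain ⟨ih1, ih2⟩ := ih (fun i => t i.succ)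
    have h0 : HasSum (fun k : ℕ => t 0 ^ k / (k.factorial : ℝ)) (Real.exp (t 0)) := by
      rw [Real.exp_eq_exp_ℝ]
      exact NormedSpace.expSeries_div_hasSum_exp (t 0)
    have h0n : Summable fun k : ℕ => ‖t 0 ^ k / (k.factorial : ℝ)‖ :=
      NormedSpace.norm_expSeries_div_summable (t 0)
    have hs := summable_mul_of_summable_norm h0n ih1
    have key := h0.mul ih2 hs
    have hfun : HasSum (fun α : Fin (n + 1) → ℕ => ∏ i, t i ^ α i / ((α i).factorial : ℝ))
        (∏ i, Real.exp (t i)) := by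
      rw [← (Fin.consEquiv fun _ : Fin (n + 1) => ℕ).hasSum_iff, Fin.prod_univ_succ]
      have e : (fun α : Fin (n + 1) → ℕ => ∏ i, t i ^ α i / ((α i).factorial : ℝ)) ∘
          (Fin.consEquiv fun _ : Fin (n + 1) => ℕ) = fun p => t 0 ^ p.1 / (p.1.factorial : ℝ) *
            ∏ i : Fin n, t i.succ ^ p.2 i / ((p.2 i).factorial : ℝ) := by
        funext p
        rw [Function.comp_apply, Fin.prod_univ_succ]
        simp only [Fin.consEquiv, Equiv.coe_fn_mk, Fin.cons_zero, Fin.cons_succ]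
      rw [e]
      exact key
    exact ⟨hfun.summable.norm, hfun⟩

theorem basisFun_mul {n : ℕ} {μ : ℝ} (hμ : 0 < μ) (α : Fin n → ℕ)
    (x y : EuclideanSpace ℝ (Fin n)) :
    basisFun μ α x * basisFun μ α y
      = ∏ i, (x i * y i / μ) ^ α i / ((α i).factorial : ℝ) := by
  have hpos : 0 ≤ μ ^ (∑ i, α i) * ∏ i, ((α i).factorial : ℝ) := by positivity
  rw [basisFun, basisFun, div_mul_div_comm, Real.mul_self_sqrt hpos, Finset.prod_div_distrib]
  simp_rw [div_pow, mul_pow]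
  rw [Finset.prod_div_distrib, Finset.prod_mul_distrib, Finset.prod_pow_eq_pow_sum, div_div]

theorem hasSum_basisFun_mul {n : ℕ} {μ : ℝ} (hμ : 0 < μ) (x y : EuclideanSpace ℝ (Fin n)) :
    HasSum (fun α : Fin n → ℕ => basisFun μ α x * basisFun μ α y)
      (Real.exp (inner ℝ x y / μ)) := by
  have h := (hasSum_prod_exp n fun i => x i * y i / μ).2
  rw [← Real.exp_sum, ← Finset.sum_div] at h
  convert h using 1
  · funext α
    exact basisFun_mul hμ α x y
  · congr 2
    rw [PiLp.inner_apply]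
    exact Finset.sum_congr rfl fun i _ => by simp [mul_comm]

theorem memlp_basisFun {n : ℕ} {μ : ℝ} (hμ : 0 < μ) (x : EuclideanSpace ℝ (Fin n)) :
    Memℓp (E := fun _ : Fin n → ℕ => ℝ) (fun α => basisFun μ α x) 2 := by
  refine memℓp_gen ?_
  refine (hasSum_basisFun_mul hμ x x).summable.congr fun α => ?_
  simp [← pow_two]

/-- The family `(basisFun μ α x)_α`, as an element of the space. -/
def featureVec {n : ℕ} (μ : ℝ) [hμ : Fact (0 < μ)] (x : EuclideanSpace ℝ (Fin n)) : Fock n μ :=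
  (⟨fun α => basisFun μ α x, memlp_basisFun hμ.out x⟩ : lp (fun _ : Fin n → ℕ => ℝ) 2)

theorem hasSum_inner_featureVec {n : ℕ} {μ : ℝ} [Fact (0 < μ)]
    (x : EuclideanSpace ℝ (Fin n)) (g : Fock n μ) :
    HasSum (fun α => g.coeff α * basisFun μ α x) (inner ℝ (featureVec μ x) g) :=
  lp.hasSum_inner (𝕜 := ℝ) (G := fun _ : Fin n → ℕ => ℝ) (featureVec μ x) g

theorem powerSeries_unique_one (b : ℕ → ℝ) (hs : ∀ t : ℝ, HasSum (fun k => b k * t ^ k) 0) :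
    b = 0 := by
  rw [← FormalMultilinearSeries.ofScalars_series_eq_zero (E := ℝ)]
  have hr : (FormalMultilinearSeries.ofScalars ℝ b).radius = ⊤ := by
    refine FormalMultilinearSeries.radius_eq_top_of_summable_norm _ fun r => ?_
    refine (hs r).summable.norm.congr fun k => ?_
    simp
  have h : HasFPowerSeriesOnBall (0 : ℝ → ℝ) (FormalMultilinearSeries.ofScalars ℝ b) 0 ⊤ := by
    refine ⟨hr.ge, by simp, fun {y} _ => ?_⟩
    simpa [FormalMultilinearSeries.ofScalars_apply_eq, mul_comm] using hs y
  exact h.hasFPowerSeriesAt.eq_zero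

theorem powerSeries_unique (n : ℕ) (a : (Fin n → ℕ) → ℝ)
    (hs : ∀ x : Fin n → ℝ, HasSum (fun α => a α * ∏ i, x i ^ α i) 0) : a = 0 := by
  induction n with
  | zero =>
    funext α
    have h := (hs 0).unique (hasSum_unique _)
    rw [Finset.univ_eq_empty, Finset.prod_empty, mul_one] at h
    exact (congrArg a (Subsingleton.elim α _)).trans h.symm
  | succ n ih =>
    have hk : ∀ k : ℕ, (fun β : Fin n → ℕ => a (Fin.cons k β)) = 0 := by
      have hsum : ∀ (t : ℝ) (y : Fin n → ℝ),
          HasSum (fun p : ℕ × (Fin n → ℕ) => t ^ p.1 * (a (Fin.cons p.1 p.2) *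
            ∏ i, y i ^ p.2 i)) 0 := by
        intro t y
        have h := hs (Fin.cons t y)
        rw [← (Fin.consEquiv fun _ : Fin (n + 1) => ℕ).hasSum_iff] at h
        convert h using 1
        funext p
        rw [Function.comp_apply, Fin.prod_univ_succ]
        simp only [Fin.consEquiv, Equiv.coe_fn_mk, Fin.cons_zero, Fin.cons_succ]
        ring
      have hinner : ∀ (k : ℕ) (y : Fin n → ℝ),
          Summable fun β : Fin n → ℕ => a (Fin.cons k β) * ∏ i, y i ^ β i := by
        intro k y
        simpa using (hsum 1 y).summable.prod_factor k
      intro k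
      refine ih _ fun y => ?_
      have hb : (fun k : ℕ => ∑' β : Fin n → ℕ, a (Fin.cons k β) * ∏ i, y i ^ β i) = 0 := by
        refine powerSeries_unique_one _ fun t => ?_
        have h := (hsum t y).prod_fiberwise fun k => ((hinner k y).hasSum.mul_left (t ^ k))
        simpa [mul_comm] using h
      have := (hinner k y).hasSum
      rwa [show ∑' β : Fin n → ℕ, a (Fin.cons k β) * ∏ i, y i ^ β i = 0 from congrFun hb k] at this
    funext α
    have := congrFun (hk (α 0)) (Fin.tail α)
    simpa [Fin.cons_self_tail] using this

theorem eq_zero_of_inner_featureVec {n : ℕ} {μ : ℝ} [hμ : Fact (0 < μ)] (g : Fock n μ)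
    (h : ∀ x, inner ℝ (featureVec μ x) g = 0) : g = 0 := by
  have h1 := powerSeries_unique n
    (fun α => g.coeff α / √(μ ^ (∑ i, α i) * ∏ i, ((α i).factorial : ℝ))) fun x => by
      have h2 := hasSum_inner_featureVec (WithLp.toLp 2 x) g
      rw [h] at h2
      have e : (fun α => g.coeff α * basisFun μ α (WithLp.toLp 2 x)) = fun α =>
          g.coeff α / √(μ ^ (∑ i, α i) * ∏ i, ((α i).factorial : ℝ)) * ∏ i, x i ^ α i := by
        funext α
        rw [basisFun]
        ring
      rwa [e] at h2
  have h3 : g.coeff = 0 := by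
    funext α
    have hpos : 0 < √(μ ^ (∑ i, α i) * ∏ i, ((α i).factorial : ℝ)) := by
      have := hμ.out
      positivity
    have h4 := congrFun h1 α
    rcases div_eq_zero_iff.mp h4 with h5 | h5
    · exact h5
    · exact absurd h5 hpos.ne'
  exact lp.ext (E := fun _ : Fin n → ℕ => ℝ) (p := 2) (f := g) (g := 0) h3

/-- `F²_μ(ℝⁿ)` is a reproducing kernel Hilbert space of functions on `ℝⁿ`; the value of an element
with coefficients `c` at `x` is `∑ α, c α * basisFun μ α x`, see `Fock.hasSum_apply`. -/
instance (n : ℕ) (μ : ℝ) [Fact (0 < μ)] : RKHS ℝ (Fock n μ) (EuclideanSpace ℝ (Fin n)) ℝ where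
  coeCLM := ContinuousLinearMap.pi fun x => innerSL ℝ (featureVec μ x)
  coeCLM_injective := by
    refine (injective_iff_map_eq_zero _).mpr fun g hg => ?_
    exact eq_zero_of_inner_featureVec g fun x => congrFun hg x

theorem Fock.hasSum_apply {n : ℕ} {μ : ℝ} [Fact (0 < μ)] (g : Fock n μ)
    (x : EuclideanSpace ℝ (Fin n)) : HasSum (fun α => g.coeff α * basisFun μ α x) (g x) :=
  hasSum_inner_featureVec x g

theorem Fock.basis_apply {n : ℕ} {μ : ℝ} [Fact (0 < μ)] (α : Fin n → ℕ)
    (x : EuclideanSpace ℝ (Fin n)) : Fock.basis μ α x = basisFun μ α x := by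
  refine ((Fock.basis μ α).hasSum_apply x).unique ?_
  convert hasSum_single α fun β hβ => ?_ using 1
  · simp [Fock.coeff, Fock.basis]
  · simp [Fock.coeff, Fock.basis, hβ]

/-- The constant function `1`. -/
def constOne (n : ℕ) (μ : ℝ) : Fock n μ := Fock.basis μ 0

theorem constOne_apply {n : ℕ} {μ : ℝ} [Fact (0 < μ)] (x : EuclideanSpace ℝ (Fin n)) :
    constOne n μ x = 1 := by
  simp [constOne, Fock.basis_apply, basisFun]

/-- The `j`-th component `x ↦ x j` of the identity observable. -/
def coordFun {n : ℕ} (μ : ℝ) (j : Fin n) : Fock n μ := √μ • Fock.basis μ (Pi.single j 1)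

theorem coordFun_apply {n : ℕ} {μ : ℝ} [hμ : Fact (0 < μ)] (j : Fin n)
    (x : EuclideanSpace ℝ (Fin n)) : coordFun μ j x = x j := by
  have h1 : ∏ i, x i ^ (Pi.single j 1 : Fin n → ℕ) i = x j := by
    rw [Finset.prod_eq_single j (fun i _ hi => by simp [hi]) (by simp)]
    simp
  have h2 : ∏ i, (((Pi.single j 1 : Fin n → ℕ) i).factorial : ℝ) = 1 := by
    refine Finset.prod_eq_one fun i _ => ?_
    by_cases hi : i = j
    · subst hi
      simp
    · simp [hi]
  have h3 : ∑ i, (Pi.single j 1 : Fin n → ℕ) i = 1 := by simp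
  have hpos : √μ ≠ 0 := (Real.sqrt_pos.mpr hμ.out).ne'
  rw [coordFun, RKHS.coe_smul, Pi.smul_apply, Fock.basis_apply, basisFun, h1, h2, h3]
  simp only [pow_one, mul_one, smul_eq_mul]
  field_simp

/-! ### Reproducing kernel, kernel differences and occupation kernels -/

/-- The kernel function `K(·, x)` centered at `x`, i.e. the Riesz representer of the evaluation
at `x`. -/
def kernelAt {n : ℕ} (μ : ℝ) [Fact (0 < μ)] (x : EuclideanSpace ℝ (Fin n)) : Fock n μ :=
  RKHS.kerFun (Fock n μ) x 1

theorem inner_kernelAt {n : ℕ} {μ : ℝ} [Fact (0 < μ)] (g : Fock n μ)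
    (x : EuclideanSpace ℝ (Fin n)) : inner ℝ g (kernelAt μ x) = g x := by
  rw [kernelAt, RKHS.inner_kerFun]
  simp

/-- The reproducing kernel is the exponential dot product kernel. -/
theorem kernelAt_apply {n : ℕ} {μ : ℝ} [hμ : Fact (0 < μ)] (x y : EuclideanSpace ℝ (Fin n)) :
    kernelAt μ y x = Real.exp (inner ℝ x y / μ) := by
  have h : kernelAt μ y = featureVec μ y := by
    refine ext_inner_left ℝ fun g => ?_
    rw [inner_kernelAt, real_inner_comm]
    rfl
  rw [h, real_inner_comm]
  exact ((featureVec μ y).hasSum_apply x).unique (hasSum_basisFun_mul hμ.out y x)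

theorem continuous_kernelAt {n : ℕ} {μ : ℝ} [Fact (0 < μ)] :
    Continuous (kernelAt μ : EuclideanSpace ℝ (Fin n) → Fock n μ) := by
  have key : ∀ x y : EuclideanSpace ℝ (Fin n), ‖kernelAt μ y - kernelAt μ x‖ =
      √(Real.exp (inner ℝ y y / μ) - 2 * Real.exp (inner ℝ x y / μ)
        + Real.exp (inner ℝ x x / μ)) := by
    intro x y
    rw [← Real.sqrt_sq (norm_nonneg (kernelAt μ y - kernelAt μ x)), @norm_sub_sq ℝ]
    simp only [← real_inner_self_eq_norm_sq, inner_kernelAt, kernelAt_apply, RCLike.re_to_real]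
  refine continuous_iff_continuousAt.mpr fun x => ?_
  rw [ContinuousAt, tendsto_iff_norm_sub_tendsto_zero]
  simp_rw [key]
  have hc : Continuous fun y : EuclideanSpace ℝ (Fin n) =>
      √(Real.exp (inner ℝ y y / μ) - 2 * Real.exp (inner ℝ x y / μ)
        + Real.exp (inner ℝ x x / μ)) := by
    fun_prop
  have h := hc.tendsto x
  convert h using 2
  rw [show Real.exp (inner ℝ x x / μ) - 2 * Real.exp (inner ℝ x x / μ)
        + Real.exp (inner ℝ x x / μ) = 0 by ring, Real.sqrt_zero]

/-- The kernel difference `K(·, γ(T)) - K(·, γ(0))` of a trajectory `γ : [0, T] → ℝⁿ`. -/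
def kernelDiff {n : ℕ} (μ : ℝ) [Fact (0 < μ)] (T : ℝ) (γ : ℝ → EuclideanSpace ℝ (Fin n)) :
    Fock n μ :=
  kernelAt μ (γ T) - kernelAt μ (γ 0)

/-- The occupation kernel `Γ_γ = ∫₀ᵀ K(·, γ(t)) dt` of a trajectory `γ : [0, T] → ℝⁿ`. It is
the Riesz representer of `g ↦ ∫₀ᵀ g(γ(t)) dt`, see `inner_occupationKernel`. -/
def occupationKernel {n : ℕ} (μ : ℝ) [Fact (0 < μ)] (T : ℝ)
    (γ : ℝ → EuclideanSpace ℝ (Fin n)) : Fock n μ :=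
  ∫ t in (0 : ℝ)..T, kernelAt μ (γ t)

theorem inner_occupationKernel {n : ℕ} {μ : ℝ} [Fact (0 < μ)] {T : ℝ} (hT : 0 ≤ T)
    {γ : ℝ → EuclideanSpace ℝ (Fin n)} (hγ : ContinuousOn γ (Set.Icc 0 T)) (g : Fock n μ) :
    inner ℝ g (occupationKernel μ T γ) = ∫ t in (0 : ℝ)..T, g (γ t) := by
  have hint : IntervalIntegrable (fun t => kernelAt μ (γ t)) volume 0 T := by
    refine ContinuousOn.intervalIntegrable ?_
    rw [Set.uIcc_of_le hT]
    exact continuous_kernelAt.comp_continuousOn hγ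
  have h := (innerSL ℝ g).intervalIntegral_comp_comm hint
  simp only [innerSL_apply_apply, inner_kernelAt] at h
  exact h.symm

/-! ### Liouville operator and the model -/

/-- `f` is component-wise polynomial. -/
def IsPolynomialField {n : ℕ} (f : EuclideanSpace ℝ (Fin n) → EuclideanSpace ℝ (Fin n)) : Prop :=
  ∃ p : Fin n → MvPolynomial (Fin n) ℝ, ∀ x j, f x j = MvPolynomial.eval (fun i => x i) (p j)

/-- `A : F²_{μd}(ℝⁿ) → F²_{μr}(ℝⁿ)` is the Liouville operator `A g = ∇g · f`. There is at most one
such `A`, because elements of `F²_{μr}(ℝⁿ)` are determined by their values. -/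
def IsLiouvilleOperator {n : ℕ} {μd μr : ℝ} [Fact (0 < μd)] [Fact (0 < μr)]
    (f : EuclideanSpace ℝ (Fin n) → EuclideanSpace ℝ (Fin n))
    (A : Fock n μd →L[ℝ] Fock n μr) : Prop :=
  ∀ (g : Fock n μd) (x : EuclideanSpace ℝ (Fin n)),
    DifferentiableAt ℝ g x ∧ A g x = fderiv ℝ g x (f x)

/-- The orthogonal projection onto the span of the first `M` members of a sequence. -/
def projSpan {H : Type*} [NormedAddCommGroup H] [InnerProductSpace ℝ H] (v : ℕ → H) (M : ℕ) :
    H →L[ℝ] H :=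
  haveI := FiniteDimensional.span_of_finite ℝ (Set.finite_range fun i : Fin M => v i)
  (Submodule.span ℝ (Set.range fun i : Fin M => v i)).starProjection

/-- The model `f̂_M`, whose `j`-th component is `P_{r^M} A P_{d^M} (h_id)_j`. -/
def sldmdModel {n : ℕ} {μd μr : ℝ} [Fact (0 < μd)] [Fact (0 < μr)]
    (A : Fock n μd →L[ℝ] Fock n μr) (d : ℕ → Fock n μd) (r : ℕ → Fock n μr) (M : ℕ)
    (x : EuclideanSpace ℝ (Fin n)) : EuclideanSpace ℝ (Fin n) :=
  WithLp.toLp 2 fun j => projSpan r M (A (projSpan d M (coordFun μd j))) x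

end BergmannFock

end

noncomputable section

namespace BergmannFock

/-! ### Weighted shifts on square summable families -/

/-! There are two independent points: the boundedness of `A`, which rests on the gap `μr < μd`, and
the convergence, which is soft Hilbert space theory.

Boundedness: pick `μr < ν < μd`. Partial derivatives map `F²_{μd}` to `F²_ν`, and polynomial
multiplications map `F²_ν` to `F²_{μr}`. In the monomial bases these come from weighted shifts with
weights such as `√(c (α j + 1) ρ ^ |α|)`, and these are bounded because the ratio `ρ` of the
parameters is below 1. Pointwise formulas are checked on kernel functions and extended by adjunction
or by density (`exists_mul_of_kernelAt`, `hasFDerivAt_of_kernelAt`).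

Convergence: `1` is the kernel at the origin, so `x j` is orthogonal to it, as are all kernel
differences. Hence `x j` lies in the closed span of the latter
(`mem_topologicalClosure_span_of_insert`). Projections are contractions and converge strongly, so
the model components converge in norm to `A (x j) = f j`. Norm convergence is uniform on `X`, where
the kernels are bounded. -/

theorem memlp_weightedShift {ι : Type*} {w : ι → ℝ} {C : ℝ} (hw : ∀ i, |w i| ≤ C) {S : ι → ι}
    (hS : S.Injective) (c : lp (fun _ : ι => ℝ) 2) :
    Memℓp (E := fun _ : ι => ℝ) (fun i => w i * c (S i)) 2 := by
  refine memℓp_gen ?_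
  have h := ((lp.memℓp c).summable (by norm_num)).comp_injective hS
  refine Summable.of_nonneg_of_le (fun i => by positivity) (fun i => ?_) (h.mul_left (C ^ 2))
  simp only [ENNReal.toReal_ofNat, Real.rpow_ofNat, Function.comp_apply, norm_mul, mul_pow,
    Real.norm_eq_abs]
  gcongr
  exact hw i

/-- The operator `c ↦ (w i * c (S i))ᵢ` on square summable families, for a bounded weight `w` and
an injective map `S`. -/
def weightedShift {ι : Type*} (w : ι → ℝ) (C : ℝ) (hw : ∀ i, |w i| ≤ C) (S : ι → ι)
    (hS : S.Injective) : lp (fun _ : ι => ℝ) 2 →L[ℝ] lp (fun _ : ι => ℝ) 2 :=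
  LinearMap.mkContinuous
    { toFun := fun c => ⟨fun i => w i * c (S i), memlp_weightedShift hw hS c⟩
      map_add' := fun a b => by
        ext i
        exact mul_add _ _ _
      map_smul' := fun a b => by
        ext i
        exact mul_left_comm _ _ _ }
    -- If `ι` is empty, `C` may be negative, whence the absolute value.
    |C| fun c => by
      refine lp.norm_le_of_tsum_le (by norm_num) (by positivity) ?_
      have hc : 0 < (2 : ENNReal).toReal := by norm_num
      have h := (lp.memℓp c).summable hc
      have h1 : ∀ i, ‖w i * c (S i)‖ ^ (2 : ENNReal).toReal ≤
          |C| ^ 2 * ‖c (S i)‖ ^ (2 : ENNReal).toReal := fun i => by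
        simp only [ENNReal.toReal_ofNat, Real.rpow_ofNat, norm_mul, mul_pow, Real.norm_eq_abs]
        refine mul_le_mul_of_nonneg_right ?_ (by positivity)
        exact pow_le_pow_left₀ (abs_nonneg _) ((hw i).trans (le_abs_self C)) 2
      have h2 := (h.comp_injective hS).mul_left (|C| ^ 2)
      have h3 := (memlp_weightedShift hw hS c).summable hc
      calc _ ≤ ∑' i, |C| ^ 2 * ‖c (S i)‖ ^ (2 : ENNReal).toReal := h3.tsum_le_tsum h1 h2
        _ = |C| ^ 2 * ∑' i, ‖c (S i)‖ ^ (2 : ENNReal).toReal := tsum_mul_left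
        _ ≤ |C| ^ 2 * ∑' i, ‖c i‖ ^ (2 : ENNReal).toReal := by
          refine mul_le_mul_of_nonneg_left ?_ (by positivity)
          exact tsum_comp_le_tsum_of_inj h (fun i => by positivity) hS
        _ = _ := by
          rw [← lp.norm_rpow_eq_tsum hc, Real.mul_rpow (abs_nonneg _) (norm_nonneg _)]
          norm_num

/-- Weighted shifts between Bergmann-Fock spaces. -/
theorem exists_weightedShift {n : ℕ} (a b : ℝ) (w : (Fin n → ℕ) → ℝ) (hw : ∃ C, ∀ α, |w α| ≤ C)
    {S : (Fin n → ℕ) → (Fin n → ℕ)} (hS : S.Injective) :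
    ∃ B : Fock n a →L[ℝ] Fock n b, ∀ g α, (B g).coeff α = w α * g.coeff (S α) := by
  obtain ⟨C, hC⟩ := hw
  exact ⟨weightedShift w C hC S hS, fun g α => rfl⟩

/-! ### Basis functions and the reproducing kernel -/

theorem kernelAt_eq_featureVec {n : ℕ} {μ : ℝ} [Fact (0 < μ)] (x : EuclideanSpace ℝ (Fin n)) :
    kernelAt μ x = featureVec μ x := by
  refine ext_inner_left ℝ fun g => ?_
  rw [inner_kernelAt, real_inner_comm]
  rfl

theorem coeff_kernelAt {n : ℕ} {μ : ℝ} [Fact (0 < μ)] (x : EuclideanSpace ℝ (Fin n))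
    (α : Fin n → ℕ) : (kernelAt μ x).coeff α = basisFun μ α x := by
  rw [kernelAt_eq_featureVec]
  rfl

theorem Fock.sum_apply {ι : Type*} {n : ℕ} {μ : ℝ} [Fact (0 < μ)] (s : Finset ι) (u : ι → Fock n μ)
    (x : EuclideanSpace ℝ (Fin n)) : (∑ i ∈ s, u i) x = ∑ i ∈ s, u i x := by
  rw [← inner_kernelAt, sum_inner]
  exact Finset.sum_congr rfl fun i _ => inner_kernelAt _ _

theorem Fock.coeff_smul {n : ℕ} {μ : ℝ} (c : ℝ) (g : Fock n μ) (α : Fin n → ℕ) :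
    (c • g).coeff α = c * g.coeff α := rfl

theorem Fock.coeff_injective {n : ℕ} {μ : ℝ} :
    (Fock.coeff : Fock n μ → (Fin n → ℕ) → ℝ).Injective := fun g h e =>
  lp.ext (E := fun _ : Fin n → ℕ => ℝ) (p := 2) (f := g) (g := h) e

theorem basisFun_rescale {n : ℕ} {μ ν : ℝ} (hμ : 0 < μ) (hν : 0 < ν) (α : Fin n → ℕ)
    (x : EuclideanSpace ℝ (Fin n)) :
    √((ν / μ) ^ ∑ i, α i) * basisFun ν α x = basisFun μ α x := by
  have h : μ ^ (∑ i, α i) * ∏ i, ((α i).factorial : ℝ) = (ν ^ (∑ i, α i) * ∏ i,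
      ((α i).factorial : ℝ)) / (ν / μ) ^ ∑ i, α i := by
    rw [div_pow]
    field_simp
  have h1 : 0 < √((ν / μ) ^ ∑ i, α i) := by positivity
  have h2 : 0 < √(ν ^ (∑ i, α i) * ∏ i, ((α i).factorial : ℝ)) := by positivity
  rw [basisFun, basisFun, h, Real.sqrt_div (by positivity)]
  field_simp

/-- The ladder relation behind both multiplication by `x j` and `∂ j`; the root is the ratio of the
two normalising constants. -/
theorem basisFun_add_single {n : ℕ} {μ : ℝ} (hμ : 0 < μ) (α : Fin n → ℕ) (j : Fin n)
    (x : EuclideanSpace ℝ (Fin n)) :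
    √(μ * (α j + 1)) * basisFun μ (α + Pi.single j 1) x = x j * basisFun μ α x := by
  have h1 : ∏ i, x i ^ (α + Pi.single j 1 : Fin n → ℕ) i = x j * ∏ i, x i ^ α i := by
    simp_rw [Pi.add_apply, pow_add]
    rw [Finset.prod_mul_distrib, mul_comm]
    congr 1
    rw [Finset.prod_eq_single j (fun i _ hi => by simp [hi]) (by simp)]
    simp
  have h2 : ∏ i, (((α + Pi.single j 1 : Fin n → ℕ) i).factorial : ℝ) =
      (α j + 1) * ∏ i, ((α i).factorial : ℝ) := by
    rw [← Finset.mul_prod_erase _ _ (Finset.mem_univ j),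
      ← Finset.mul_prod_erase Finset.univ (fun i => ((α i).factorial : ℝ)) (Finset.mem_univ j),
      ← mul_assoc]
    congr 1
    · simp [Nat.factorial_succ]
    · refine Finset.prod_congr rfl fun i hi => ?_
      simp [Finset.ne_of_mem_erase hi]
  have h3 : ∑ i, (α + Pi.single j 1 : Fin n → ℕ) i = ∑ i, α i + 1 := by
    simp [Finset.sum_add_distrib]
  have h4 : μ ^ (∑ i, α i + 1) * ((α j + 1) * ∏ i, ((α i).factorial : ℝ)) =
      (μ * (α j + 1)) * (μ ^ (∑ i, α i) * ∏ i, ((α i).factorial : ℝ)) := by ring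
  have h5 : 0 < √(μ * (α j + 1)) := by positivity
  have h6 : 0 < √(μ ^ (∑ i, α i) * ∏ i, ((α i).factorial : ℝ)) := by positivity
  rw [basisFun, basisFun, h1, h2, h3, h4,
    Real.sqrt_mul (x := μ * (α j + 1)) (by positivity), mul_div_assoc', mul_div_mul_left _ _ h5.ne',
    mul_div_assoc]

theorem exists_bound_sqrt_pow {n : ℕ} {ρ : ℝ} (h0 : 0 < ρ) (h1 : ρ < 1) :
    ∃ C, ∀ α : Fin n → ℕ, |√(ρ ^ ∑ i, α i)| ≤ C := by
  refine ⟨1, fun α => ?_⟩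
  rw [abs_of_nonneg (Real.sqrt_nonneg _), Real.sqrt_le_one]
  exact pow_le_one₀ h0.le h1.le

/-- The geometric factor absorbs the linear growth: `k * ρ ^ k` tends to 0, and `α j ≤ |α|`. -/
theorem exists_bound_sqrt_mul_pow {n : ℕ} {ρ : ℝ} (h0 : 0 < ρ) (h1 : ρ < 1) (c : ℝ) (hc : 0 < c)
    (j : Fin n) : ∃ C, ∀ α : Fin n → ℕ, |√(c * (α j + 1)) * √(ρ ^ ∑ i, α i)| ≤ C := by
  obtain ⟨C, hC⟩ := (tendsto_self_mul_const_pow_of_lt_one h0.le h1).bddAbove_range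
  -- `C` bounds `|α| * ρ ^ |α|`, and 1 bounds `ρ ^ |α|`.
  refine ⟨√(c * (C + 1)), fun α => ?_⟩
  rw [abs_of_nonneg (by positivity), ← Real.sqrt_mul (by positivity), mul_assoc]
  refine Real.sqrt_le_sqrt (mul_le_mul_of_nonneg_left ?_ hc.le)
  have h2 : (α j : ℝ) ≤ (∑ i, α i : ℕ) :=
    Nat.cast_le.mpr (Finset.single_le_sum (fun _ _ => Nat.zero_le _) (Finset.mem_univ j))
  have h3 : ((∑ i, α i : ℕ) : ℝ) * ρ ^ (∑ i, α i) ≤ C := hC ⟨∑ i, α i, rfl⟩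
  have h4 : ρ ^ (∑ i, α i) ≤ 1 := pow_le_one₀ h0.le h1.le
  have h5 : (α j : ℝ) * ρ ^ (∑ i, α i) ≤ (∑ i, α i : ℕ) * ρ ^ (∑ i, α i) := by gcongr
  linarith

/-! ### Multiplication by polynomials -/

/-- The adjoint of `B` is multiplication by `φ`, since `⟨B* g, K_x⟩ = ⟨g, B K_x⟩ = φ x * g x`. -/
theorem exists_mul_of_kernelAt {n : ℕ} {μ ν : ℝ} [Fact (0 < μ)] [Fact (0 < ν)]
    (φ : EuclideanSpace ℝ (Fin n) → ℝ) (B : Fock n ν →L[ℝ] Fock n μ)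
    (hB : ∀ x, B (kernelAt ν x) = φ x • kernelAt μ x) :
    ∃ M : Fock n μ →L[ℝ] Fock n ν, ∀ g x, M g x = φ x * g x := by
  refine ⟨ContinuousLinearMap.adjoint B, fun g x => ?_⟩
  rw [← inner_kernelAt, ContinuousLinearMap.adjoint_inner_left, hB, inner_smul_right,
    inner_kernelAt]

theorem exists_inclusion {n : ℕ} {μ ν : ℝ} [hμ : Fact (0 < μ)] [hν : Fact (0 < ν)] (h : ν < μ) :
    ∃ J : Fock n μ →L[ℝ] Fock n ν, ∀ g x, J g x = g x := by
  obtain ⟨B, hB⟩ := exists_weightedShift ν μ (fun α : Fin n → ℕ => √((ν / μ) ^ ∑ i, α i))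
    (exists_bound_sqrt_pow (div_pos hν.out hμ.out) ((div_lt_one hμ.out).mpr h))
    Function.injective_id
  obtain ⟨M, hM⟩ := exists_mul_of_kernelAt (fun _ => 1) B fun x => by
    refine Fock.coeff_injective (funext fun α => ?_)
    rw [hB, Fock.coeff_smul, coeff_kernelAt, coeff_kernelAt, one_mul]
    exact basisFun_rescale hμ.out hν.out α x
  exact ⟨M, fun g x => by rw [hM, one_mul]⟩

theorem exists_mul_coord {n : ℕ} {μ ν : ℝ} [hμ : Fact (0 < μ)] [hν : Fact (0 < ν)] (h : ν < μ)
    (j : Fin n) : ∃ M : Fock n μ →L[ℝ] Fock n ν, ∀ g x, M g x = x j * g x := by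
  obtain ⟨B, hB⟩ := exists_weightedShift ν μ
    (fun α : Fin n → ℕ => √(ν * (α j + 1)) * √((ν / μ) ^ ∑ i, α i))
    (exists_bound_sqrt_mul_pow (div_pos hν.out hμ.out) ((div_lt_one hμ.out).mpr h) ν hν.out j)
    (add_left_injective (Pi.single j 1))
  refine exists_mul_of_kernelAt (fun x => x j) B fun x => ?_
  refine Fock.coeff_injective (funext fun α => ?_)
  rw [hB, Fock.coeff_smul, coeff_kernelAt, coeff_kernelAt, mul_right_comm,
    basisFun_add_single hν.out, mul_assoc, mul_comm (basisFun ν α x), basisFun_rescale hμ.out hν.out]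

theorem exists_mul_polynomial {n : ℕ} (p : MvPolynomial (Fin n) ℝ) : ∀ {μ ν : ℝ} [Fact (0 < μ)]
    [Fact (0 < ν)], ν < μ → ∃ M : Fock n μ →L[ℝ] Fock n ν,
      ∀ g x, M g x = MvPolynomial.eval (fun i => x i) p * g x := by
  induction p using MvPolynomial.induction_on with
  | C a =>
    intro μ ν _ _ h
    obtain ⟨J, hJ⟩ := exists_inclusion (n := n) h
    exact ⟨a • J, fun g x => by simp [RKHS.coe_smul, hJ]⟩
  | add p q hp hq =>
    intro μ ν _ _ h
    obtain ⟨P, hP⟩ := hp h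
    obtain ⟨Q, hQ⟩ := hq h
    exact ⟨P + Q, fun g x => by simp [RKHS.coe_add, hP, hQ, add_mul]⟩
  | mul_X p j hp =>
    intro μ ν _ hν h
    -- Each factor `X j` costs some of the parameter gap; the induction hypothesis covers all gaps,
    -- so this one can be split.
    obtain ⟨ξ, h1, h2⟩ := exists_between h
    have : Fact (0 < ξ) := ⟨hν.out.trans h1⟩
    obtain ⟨P, hP⟩ := hp h1
    obtain ⟨Q, hQ⟩ := exists_mul_coord h2 j
    exact ⟨P.comp Q, fun g x => by simp [hP, hQ, mul_assoc]⟩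

/-! ### Differentiation -/

/-- The coefficients of the kernel at `y` are `basisFun μ α y`, so by the ladder relation the
lowering shift multiplies it by `y j`, which is `∂ j` up to the factor `μ`. The extra weight
converts coefficients from `μ` to `ν`. -/
theorem exists_partialDeriv_kernelAt {n : ℕ} {μ ν : ℝ} [hμ : Fact (0 < μ)] [hν : Fact (0 < ν)]
    (h : ν < μ) (j : Fin n) : ∃ D : Fock n μ →L[ℝ] Fock n ν, ∀ y x,
      D (kernelAt μ y) x = y j / μ * kernelAt μ y x := by
  obtain ⟨B, hB⟩ := exists_weightedShift μ ν
    (fun α : Fin n → ℕ => √(μ * (α j + 1)) * √((ν / μ) ^ ∑ i, α i))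
    (exists_bound_sqrt_mul_pow (div_pos hν.out hμ.out) ((div_lt_one hμ.out).mpr h) μ hμ.out j)
    (add_left_injective (Pi.single j 1))
  refine ⟨μ⁻¹ • B, fun y x => ?_⟩
  rw [smul_apply, RKHS.coe_smul, Pi.smul_apply, smul_eq_mul, div_eq_inv_mul,
    mul_assoc]
  congr 1
  refine ((B (kernelAt μ y)).hasSum_apply x).unique ?_
  refine (((kernelAt μ y).hasSum_apply x).mul_left (y j)).congr_fun fun α => ?_
  rw [hB, coeff_kernelAt, coeff_kernelAt]
  linear_combination (√((ν / μ) ^ ∑ i, α i) * basisFun ν α x) * basisFun_add_single hμ.out α j y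
    + y j * basisFun μ α y * basisFun_rescale hμ.out hν.out α x

theorem span_kernelAt_topologicalClosure {n : ℕ} {μ : ℝ} [Fact (0 < μ)] :
    (Submodule.span ℝ (Set.range
      (kernelAt μ : EuclideanSpace ℝ (Fin n) → Fock n μ))).topologicalClosure = ⊤ := by
  refine Submodule.orthogonal_eq_bot_iff.mp ((Submodule.eq_bot_iff _).mpr fun g hg => ?_)
  refine RKHS.ext fun x => ?_
  rw [← inner_kernelAt, real_inner_comm, RKHS.coe_zero]
  exact Submodule.inner_right_of_mem_orthogonal
    (Submodule.le_topologicalClosure _ (Submodule.subset_span (Set.mem_range_self x))) hg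

/-- This is what turns norm convergence into uniform convergence on compact sets. -/
theorem exists_norm_kerFun_le {n : ℕ} (μ : ℝ) [Fact (0 < μ)] {s : Set (EuclideanSpace ℝ (Fin n))}
    (hs : IsCompact s) : ∃ C, ∀ x ∈ s, ‖RKHS.kerFun (Fock n μ) x‖ ≤ C := by
  obtain ⟨C, hC⟩ := hs.exists_bound_of_continuousOn
    (continuous_kernelAt (μ := μ) (n := n)).continuousOn
  refine ⟨C, fun x hx => ?_⟩
  refine ContinuousLinearMap.opNorm_le_bound _ ((norm_nonneg _).trans (hC x hx)) fun v => ?_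
  have h : RKHS.kerFun (Fock n μ) x v = v • kernelAt μ x := by
    rw [kernelAt, ← map_smul, smul_eq_mul, mul_one]
  rw [h, norm_smul, mul_comm]
  gcongr
  exact hC x hx

theorem hasFDerivAt_kernelAt {n : ℕ} {μ : ℝ} [hμ : Fact (0 < μ)]
    (y x : EuclideanSpace ℝ (Fin n)) :
    HasFDerivAt (kernelAt μ y)
      (∑ j, (y j / μ * kernelAt μ y x) • (EuclideanSpace.proj j : _ →L[ℝ] ℝ)) x := by
  have e : ⇑(kernelAt μ y) = fun z => Real.exp (μ⁻¹ * innerSL ℝ y z) := by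
    funext z
    rw [kernelAt_apply, innerSL_apply_apply, real_inner_comm, div_eq_inv_mul]
  have h := (((innerSL ℝ y).hasFDerivAt (x := x)).const_mul μ⁻¹).exp
  rw [e]
  refine h.congr_fderiv ?_
  ext v
  simp only [smul_apply, sum_apply, smul_eq_mul, PiLp.proj_apply,
    innerSL_apply_apply]
  rw [PiLp.inner_apply y v, Finset.mul_sum, Finset.mul_sum]
  refine Finset.sum_congr rfl fun j _ => ?_
  simp only [RCLike.inner_apply, conj_trivial]
  ring

/-- The formula holds on the dense span of the kernels by linearity. Along an approximating sequence
the derivatives converge uniformly near `x`, so the limit may be differentiated term by term. -/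
theorem hasFDerivAt_of_kernelAt {n : ℕ} {μ ν : ℝ} [hμ : Fact (0 < μ)] [hν : Fact (0 < ν)]
    (D : Fin n → Fock n μ →L[ℝ] Fock n ν)
    (hD : ∀ j y x, D j (kernelAt μ y) x = y j / μ * kernelAt μ y x)
    (g : Fock n μ) (x : EuclideanSpace ℝ (Fin n)) :
    HasFDerivAt g (∑ j, D j g x • (EuclideanSpace.proj j : _ →L[ℝ] ℝ)) x := by
  have hspan : ∀ h ∈ Submodule.span ℝ (Set.range (kernelAt μ : _ → Fock n μ)),
      ∀ z, HasFDerivAt h (∑ j, D j h z • (EuclideanSpace.proj j : _ →L[ℝ] ℝ)) z := by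
    intro h hh z
    induction hh using Submodule.span_induction with
    | mem h hh =>
      obtain ⟨y, rfl⟩ := hh
      simp_rw [hD]
      exact hasFDerivAt_kernelAt y z
    | zero =>
      rw [RKHS.coe_zero]
      refine (hasFDerivAt_const (0 : ℝ) z).congr_fderiv ?_
      simp [RKHS.coe_zero]
    | add a b _ _ ha hb =>
      rw [RKHS.coe_add]
      refine (ha.add hb).congr_fderiv ?_
      simp only [map_add, RKHS.coe_add, Pi.add_apply, add_smul, Finset.sum_add_distrib]
    | smul c a _ ha =>
      rw [RKHS.coe_smul]
      refine (ha.const_smul c).congr_fderiv ?_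
      simp only [map_smul, RKHS.coe_smul, Pi.smul_apply, smul_assoc, Finset.smul_sum]
  have hg : g ∈ closure (Submodule.span ℝ (Set.range (kernelAt μ : _ → Fock n μ)) :
      Set (Fock n μ)) := by
    rw [← Submodule.topologicalClosure_coe, span_kernelAt_topologicalClosure]
    trivial
  obtain ⟨u, hu, hlim⟩ := mem_closure_iff_seq_limit.mp hg
  obtain ⟨C, hC⟩ := exists_norm_kerFun_le ν (isCompact_closedBall x 1)
  refine hasFDerivAt_of_tendstoUniformlyOn (l := atTop) Metric.isOpen_ball (f := fun k => u k)
    (f' := fun k z => ∑ j, D j (u k) z • (EuclideanSpace.proj j : _ →L[ℝ] ℝ))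
    (g' := fun z => ∑ j, D j g z • (EuclideanSpace.proj j : _ →L[ℝ] ℝ)) ?_
    (fun k z _ => hspan _ (hu k) z)
    (fun z _ => ((RKHS.continuous_eval (H := Fock n μ) z).tendsto g).comp hlim)
    (Metric.mem_ball_self one_pos)
  have hj : ∀ j, TendstoUniformlyOn (fun k => ⇑(D j (u k))) (D j g) atTop (Metric.ball x 1) :=
    fun j => RKHS.tendstoUniformlyOn_of_norm_kerFun_le
      (fun z hz => hC z (Metric.ball_subset_closedBall hz)) (((D j).continuous.tendsto g).comp hlim)
  -- Passes from scalars `c` to functionals `c • proj j` by a uniformly continuous map.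
  have hp := fun j => (ContinuousLinearMap.toSpanSingleton ℝ
    (EuclideanSpace.proj j : EuclideanSpace ℝ (Fin n) →L[ℝ] ℝ)).uniformContinuous
      |>.comp_tendstoUniformlyOn (hj j)
  induction (Finset.univ : Finset (Fin n)) using Finset.induction_on with
  | empty => simp +contextual [Metric.tendstoUniformlyOn_iff]
  | insert j s hjs ih =>
    simp_rw [Finset.sum_insert hjs]
    exact (hp j).add ih

/-! ### The Liouville operator -/

theorem exists_isLiouvilleOperator {n : ℕ} {μr μd : ℝ} [hμr : Fact (0 < μr)] [Fact (0 < μd)]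
    (hμ : μr < μd) {f : EuclideanSpace ℝ (Fin n) → EuclideanSpace ℝ (Fin n)}
    (hf : IsPolynomialField f) : ∃ A : Fock n μd →L[ℝ] Fock n μr, IsLiouvilleOperator f A := by
  obtain ⟨p, hp⟩ := hf
  obtain ⟨ν, h1, h2⟩ := exists_between hμ
  have : Fact (0 < ν) := ⟨hμr.out.trans h1⟩
  choose D hD using fun j : Fin n => exists_partialDeriv_kernelAt h2 j
  choose P hP using fun j : Fin n => exists_mul_polynomial (p j) h1
  refine ⟨∑ j, (P j).comp (D j), fun g x => ?_⟩
  have h := hasFDerivAt_of_kernelAt D hD g x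
  refine ⟨h.differentiableAt, ?_⟩
  rw [h.fderiv, sum_apply, Fock.sum_apply, sum_apply]
  refine Finset.sum_congr rfl fun j _ => ?_
  simp [hP, hp, mul_comm]

theorem IsLiouvilleOperator.apply_coordFun {n : ℕ} {μr μd : ℝ} [Fact (0 < μr)] [Fact (0 < μd)]
    {f : EuclideanSpace ℝ (Fin n) → EuclideanSpace ℝ (Fin n)} {A : Fock n μd →L[ℝ] Fock n μr}
    (hA : IsLiouvilleOperator f A) (j : Fin n) (x : EuclideanSpace ℝ (Fin n)) :
    A (coordFun μd j) x = f x j := by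
  have e : ⇑(coordFun μd j) = (EuclideanSpace.proj j : EuclideanSpace ℝ (Fin n) →L[ℝ] ℝ) :=
    funext fun z => coordFun_apply j z
  rw [(hA _ x).2, e, ContinuousLinearMap.fderiv, PiLp.proj_apply]

/-! ### Projections onto spans of growing families -/

theorem projSpan_norm_le {H : Type*} [NormedAddCommGroup H] [InnerProductSpace ℝ H] (v : ℕ → H)
    (M : ℕ) (h : H) : ‖projSpan v M h‖ ≤ ‖h‖ :=
  haveI := FiniteDimensional.span_of_finite ℝ (Set.finite_range fun i : Fin M => v i)
  Submodule.norm_starProjection_apply_le _ h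

theorem tendsto_projSpan {H : Type*} [NormedAddCommGroup H] [InnerProductSpace ℝ H]
    [CompleteSpace H] (v : ℕ → H) {h : H}
    (hh : h ∈ (Submodule.span ℝ (Set.range v)).topologicalClosure) :
    Tendsto (fun M => projSpan v M h) atTop (𝓝 h) := by
  have hfin (M : ℕ) := FiniteDimensional.span_of_finite ℝ (Set.finite_range fun i : Fin M => v i)
  have hmono : Monotone fun M : ℕ => Submodule.span ℝ (Set.range fun i : Fin M => v i) := by
    refine fun M N hMN => Submodule.span_mono ?_
    rintro _ ⟨i, rfl⟩
    exact ⟨Fin.castLE hMN i, rfl⟩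
  have hsup : ⨆ M : ℕ, Submodule.span ℝ (Set.range fun i : Fin M => v i) =
      Submodule.span ℝ (Set.range v) := by
    rw [← Submodule.span_iUnion]
    congr 1
    ext z
    simp only [Set.mem_iUnion, Set.mem_range]
    exact ⟨fun ⟨_, i, hi⟩ => ⟨i, hi⟩, fun ⟨i, hi⟩ => ⟨i + 1, ⟨i, i.lt_succ_self⟩, hi⟩⟩
  have ht := Submodule.starProjection_tendsto_closure_iSup
    (fun M : ℕ => Submodule.span ℝ (Set.range fun i : Fin M => v i)) hmono h
  rwa [Submodule.starProjection_eq_self_iff.mpr (by rwa [hsup])] at ht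

/-- The residual of `h` after projection onto `K` is orthogonal to `s`, and also to `e` because both
`h` and `K` are. It is thus orthogonal to a dense subspace. -/
theorem mem_topologicalClosure_span_of_insert {H : Type*} [NormedAddCommGroup H]
    [InnerProductSpace ℝ H] [CompleteSpace H] {e : H} {s : Set H}
    (hs : Dense (Submodule.span ℝ (insert e s) : Set H)) (he : ∀ v ∈ s, inner ℝ e v = 0) {h : H}
    (heh : inner ℝ e h = 0) : h ∈ (Submodule.span ℝ s).topologicalClosure := by
  set K := (Submodule.span ℝ s).topologicalClosure
  have hK : K ≤ (Submodule.span ℝ {e})ᗮ := by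
    refine Submodule.topologicalClosure_minimal _ (Submodule.span_le.mpr fun v hv => ?_)
      (Submodule.isClosed_orthogonal _)
    exact Submodule.mem_orthogonal_singleton_iff_inner_right.mpr (he v hv)
  have hP : K.starProjection h ∈ K := Submodule.starProjection_apply_mem K h
  have hz : h - K.starProjection h = 0 := by
    refine hs.eq_zero_of_inner_right ℝ fun u hu => ?_
    refine Submodule.span_induction (p := fun u _ => inner ℝ u (h - K.starProjection h) = 0)
      ?_ (inner_zero_left _) (fun a b _ _ ha hb => by rw [inner_add_left, ha, hb, add_zero])
      (fun c a _ ha => by rw [inner_smul_left, ha, mul_zero]) hu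
    rintro u (rfl | hu)
    · rw [inner_sub_right, heh, Submodule.mem_orthogonal_singleton_iff_inner_right.mp (hK hP),
        sub_zero]
    · exact Submodule.inner_right_of_mem_orthogonal
        (subset_closure (Submodule.subset_span hu)) (K.sub_starProjection_mem_orthogonal h)
  rw [sub_eq_zero.mp hz]
  exact hP

/-- Makes orthogonality to the constants the same as vanishing at the origin. -/
theorem constOne_eq_kernelAt {n : ℕ} {μ : ℝ} [Fact (0 < μ)] : constOne n μ = kernelAt μ 0 := by
  refine RKHS.ext fun x => ?_
  rw [constOne_apply, kernelAt_apply, inner_zero_right, zero_div, Real.exp_zero]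

theorem inner_constOne {n : ℕ} {μ : ℝ} [Fact (0 < μ)] (g : Fock n μ) :
    inner ℝ (constOne n μ) g = g 0 := by
  rw [constOne_eq_kernelAt, real_inner_comm, inner_kernelAt]

theorem inner_constOne_kernelDiff {n : ℕ} {μ : ℝ} [Fact (0 < μ)] (T : ℝ)
    (γ : ℝ → EuclideanSpace ℝ (Fin n)) : inner ℝ (constOne n μ) (kernelDiff μ T γ) = 0 := by
  rw [kernelDiff, inner_sub_right, inner_kernelAt, inner_kernelAt, constOne_apply, constOne_apply,
    sub_self]

theorem tendsto_projSpan_comp_projSpan {H K : Type*} [NormedAddCommGroup H] [InnerProductSpace ℝ H]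
    [CompleteSpace H] [NormedAddCommGroup K] [InnerProductSpace ℝ K] [CompleteSpace K]
    (A : H →L[ℝ] K) (d : ℕ → H) (r : ℕ → K) {h : H}
    (hd : h ∈ (Submodule.span ℝ (Set.range d)).topologicalClosure)
    (hr : A h ∈ (Submodule.span ℝ (Set.range r)).topologicalClosure) :
    Tendsto (fun M => projSpan r M (A (projSpan d M h))) atTop (𝓝 (A h)) := by
  have h1 := (A.continuous.tendsto h).comp (tendsto_projSpan d hd)
  -- Both projections move with `M`; contractivity of the outer one controls the error of the inner
  -- one.
  have h2 : Tendsto (fun M => projSpan r M (A (projSpan d M h) - A h)) atTop (𝓝 0) := by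
    refine squeeze_zero_norm (fun M => projSpan_norm_le r M _) ?_
    exact tendsto_iff_norm_sub_tendsto_zero.mp h1
  have h3 := h2.add (tendsto_projSpan r hr)
  simpa using h3

end BergmannFock

end

theorem mainTheorem1 (n : ℕ) (μr μd : ℝ) [Fact (0 < μr)] [Fact (0 < μd)] (hμ : μr < μd)
    (X : Set (EuclideanSpace ℝ (Fin n))) (hX : IsCompact X)
    (f : EuclideanSpace ℝ (Fin n) → EuclideanSpace ℝ (Fin n))
    (hf : BergmannFock.IsPolynomialField f)
    (T : ℕ → ℝ) (hT : ∀ i, 0 ≤ T i)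
    (γ : ℕ → ℝ → EuclideanSpace ℝ (Fin n))
    (hγ : ∀ i, ContinuousOn (γ i) (Set.Icc 0 (T i)))
    (hγX : ∀ i, Set.MapsTo (γ i) (Set.Icc 0 (T i)) X)
    (hd : Dense (Submodule.span ℝ (insert (BergmannFock.constOne n μd)
      (Set.range fun i => BergmannFock.kernelDiff μd (T i) (γ i))) :
        Set (BergmannFock.Fock n μd)))
    (hr : Dense (Submodule.span ℝ
      (Set.range fun i => BergmannFock.occupationKernel μr (T i) (γ i)) :
        Set (BergmannFock.Fock n μr))) :
    ∃ A : BergmannFock.Fock n μd →L[ℝ] BergmannFock.Fock n μr,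
      BergmannFock.IsLiouvilleOperator f A ∧
      TendstoUniformlyOn
        (fun M => BergmannFock.sldmdModel A
          (fun i => BergmannFock.kernelDiff μd (T i) (γ i))
          (fun i => BergmannFock.occupationKernel μr (T i) (γ i)) M)
        f atTop X := by
  obtain ⟨A, hA⟩ := BergmannFock.exists_isLiouvilleOperator hμ hf
  refine ⟨A, hA, ?_⟩
  obtain ⟨C, hC⟩ := BergmannFock.exists_norm_kerFun_le μr hX
  have hj : ∀ j, TendstoUniformlyOn (fun M x => BergmannFock.sldmdModel A
      (fun i => BergmannFock.kernelDiff μd (T i) (γ i))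
      (fun i => BergmannFock.occupationKernel μr (T i) (γ i)) M x j)
      (fun x => f x j) atTop X := by
    intro j
    have hcoord : BergmannFock.coordFun μd j ∈ (Submodule.span ℝ
        (Set.range fun i => BergmannFock.kernelDiff μd (T i) (γ i))).topologicalClosure := by
      refine BergmannFock.mem_topologicalClosure_span_of_insert hd ?_ ?_
      · rintro _ ⟨i, rfl⟩
        exact BergmannFock.inner_constOne_kernelDiff _ _
      · rw [BergmannFock.inner_constOne, BergmannFock.coordFun_apply]
        rfl
    have h := RKHS.tendstoUniformlyOn_of_norm_kerFun_le hC
      (BergmannFock.tendsto_projSpan_comp_projSpan A _ _ hcoord (hr _))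
    rwa [show ⇑(A (BergmannFock.coordFun μd j)) = fun x => f x j from
      funext fun x => hA.apply_coordFun j x] at h
  -- The finitely many components are combined in the sup norm, then carried to the Euclidean norm
  -- by uniform continuity of `toLp`.
  have hpi : TendstoUniformlyOn (fun M x => WithLp.ofLp (BergmannFock.sldmdModel A
      (fun i => BergmannFock.kernelDiff μd (T i) (γ i))
      (fun i => BergmannFock.occupationKernel μr (T i) (γ i)) M x))
      (fun x => WithLp.ofLp (f x)) atTop X := by
    rw [Metric.tendstoUniformlyOn_iff]
    intro ε hε
    filter_upwards [eventually_all.mpr fun j => Metric.tendstoUniformlyOn_iff.mp (hj j) ε hε]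
      with M hM x hx
    exact (dist_pi_lt_iff hε).mpr fun j => hM j x hx
  exact (PiLp.uniformContinuous_toLp 2 fun _ : Fin n => ℝ).comp_tendstoUniformlyOn hpi
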